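/- Let $n\ge 2$ and let $\overrightarrow{C_n}$ be the directed cycle with vertex set $[n]=\{1,\dots,n\}$ and edge set $E=\{(i,i+1)\mid 1\le i<n\}\cup\{(n,1)\}$, and let $C_n$ be its underlying simple undirected graph (directions are forgotten and double edges are combined). Let $$X_{\overrightarrow{C_n}}(\mathbf x,t)=\sum_{\kappa}t^{\operatorname{asc}(\kappa)}\prod_{i=1}^n x_{\kappa(i)},$$ a formal power series in $x_1,x_2,\dots$ with coefficients in $\mathbb Q[t]$, where $\kappa$ ranges over all proper colorings $\kappa:[n]\to\{1,2,3,\dots\}$ of $C_n$ and $\operatorname{asc}(\kappa)$ is the number of edges $(i,j)\in E$ with $\kappa(i)<\kappa(j)$. For a partition $\lambda=(\lambda_1,\dots,\lambda_k)$ of $n$ let $e_\lambda=e_{\lambda_1}\cdots e_{\lambda_k}$, where $e_r$ is the $r$-th elementary symmetric function in $x_1,x_2,\dots$. Then there are unique polynomials $c_\lambda(t)\in\mathbb Q[t]$, $\lambda\vdash n$, with $$X_{\overrightarrow{C_n}}(\mathbf x,t)=\sum_{\lambda\vdash n}c_\lambda(t)\,e_\lambda(\mathbf x),$$ and they are given by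 $$c_\lambda(t)=\sum_{D\in AO_\lambda(C_n)}t^{\operatorname{asc}_{\overrightarrow{C_n}}(D)}.$$ Here $\operatorname{asc}_{\overrightarrow{C_n}}(D)$ is the number of directed edges of $\overrightarrow{C_n}$ that are oriented as in $D$, and $AO_\lambda(C_n)$ is the set of all acyclic orientations $D$ of $C_n$ such that the numbers of vertices between consecutive sinks of $D$ are $\lambda_1-1,\dots,\lambda_k-1$ in some order. A sink is a vertex with no outgoing edge. For a sink $i$, let $j$ be the first sink reached after leaving $i$ when going around the circle $1,2,\dots,n,1,\dots$ in increasing direction (so $j=i$ if $i$ is the only sink); then $i,j$ are consecutive sinks, and the vertices passed strictly between them are the vertices between them. In particular, if $D$ has only one sink, the only such number is $n-1$. -/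

import Mathlib

open scoped Polynomial

noncomputable section

namespace ChromaticDigraph

/-- The simple undirected graph underlying a digraph: orientations are removed and double edges are
combined into single edges. -/
abbrev underlying {V : Type*} (G : Digraph V) : SimpleGraph V := G.toSimpleGraphInclusive

/-- Proper colorings of a digraph by positive integers: proper colorings of the underlying graph. -/
abbrev ProperColoring {V : Type*} (G : Digraph V) : Type _ := (underlying G).Coloring ℕ+

/-- The number of ascents of `κ`: directed edges `(u, v)` of `G` with `κ u < κ v`. -/
def colorAsc {V : Type*} (G : Digraph V) (κ : ProperColoring G) : ℕ :=
  {p : V × V | G.Adj p.1 p.2 ∧ κ p.1 < κ p.2}.ncard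

/-- The exponent vector of the monomial `x_κ = ∏ v, x_{κ v}`. -/
def colorWeight {V : Type*} [Fintype V] (G : Digraph V) (κ : ProperColoring G) : ℕ+ →₀ ℕ :=
  ∑ v, Finsupp.single (κ v) 1

/-- Only finitely many proper colorings have a given monomial, so the sum in
`chromaticQuasisymmetric` below is a genuine finite sum. -/
theorem finite_colorWeight_eq {V : Type*} [Fintype V] (G : Digraph V) (m : ℕ+ →₀ ℕ) :
    {κ : ProperColoring G | colorWeight G κ = m}.Finite := by
  classical
  have h : (Set.pi Set.univ fun _ : V => (m.support : Set ℕ+)).Finite :=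
    Set.Finite.pi fun _ => m.support.finite_toSet
  refine Set.Finite.of_injOn (f := fun (κ : ProperColoring G) (v : V) => κ v) ?_
    (fun κ _ κ' _ e => DFunLike.coe_injective e) h
  rintro κ rfl v -
  simp only [Finset.mem_coe, Finsupp.mem_support_iff, colorWeight, Finsupp.finsetSum_apply]
  intro h0
  have := (Finset.sum_eq_zero_iff.1 h0) v (Finset.mem_univ v)
  simp at this

/-- The chromatic quasisymmetric function `∑_κ t ^ asc(κ) x_κ` of a finite digraph, over all proper
colorings `κ`, as a formal power series in the variables `x₁, x₂, …` with coefficients in `ℚ[t]`. -/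
def chromaticQuasisymmetric {V : Type*} [Fintype V] (G : Digraph V) : MvPowerSeries ℕ+ ℚ[X] :=
  fun m => ∑ᶠ κ ∈ {κ : ProperColoring G | colorWeight G κ = m}, (Polynomial.X : ℚ[X]) ^ colorAsc G κ

open Classical in
/-- The elementary symmetric function `e_k` in `x₁, x₂, …`: the sum of all squarefree monomials of
degree `k`. -/
def elementary (k : ℕ) : MvPowerSeries ℕ+ ℚ[X] :=
  fun m => if (∀ i, m i ≤ 1) ∧ m.degree = k then 1 else 0

/-- `e_λ`, the product of the `e_{λ_i}` over the parts of `λ`. -/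
def elementaryPart {n : ℕ} (lam : n.Partition) : MvPowerSeries ℕ+ ℚ[X] :=
  (lam.parts.map elementary).prod

/-- `D` is an acyclic orientation of the graph `G`: each edge of `G` gets exactly one of its two
directions, and there is no directed closed walk of positive length. -/
structure IsAcyclicOrientation {V : Type*} (G : SimpleGraph V) (D : Digraph V) : Prop where
  adj_iff : ∀ u v, G.Adj u v ↔ D.Adj u v ∨ D.Adj v u
  antisymm : ∀ u v, D.Adj u v → ¬ D.Adj v u
  acyclic : ∀ v, ¬ Relation.TransGen D.Adj v v

/-- The number of directed edges of `G` that are oriented as in `D`. -/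
def orientationAsc {V : Type*} (G D : Digraph V) : ℕ :=
  {p : V × V | G.Adj p.1 p.2 ∧ D.Adj p.1 p.2}.ncard

/-- A sink: a vertex with no outgoing edge. -/
def IsSink {V : Type*} (D : Digraph V) (v : V) : Prop := ∀ w, ¬ D.Adj v w

/-- The directed cycle `0 → 1 → ⋯ → n - 1 → 0` (the vertices `1, …, n` are numbered from `0`). -/
def directedCycle (n : ℕ) : Digraph (Fin n) where
  Adj i j := i.val + 1 = j.val ∨ (i.val + 1 = n ∧ j.val = 0)

/-- The vertices strictly between `i` and `j` when one goes around the circle `0, 1, …, n - 1` from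
`i` in increasing direction until `j` is reached for the first time; if `i = j` one goes around once,
so these are all the other vertices. (`k - i` is subtraction modulo `n`.) -/
def between {n : ℕ} (i j : Fin n) : Finset (Fin n) :=
  {k | 0 < (k - i).val ∧ (k - i).val < if i = j then n else (j - i).val}

/-- `i` and `j` are sinks and there is no other sink on the way around the circle from `i` to `j`.
If there is only one sink, it is consecutive to itself. -/
def ConsecutiveSinks {n : ℕ} (D : Digraph (Fin n)) (i j : Fin n) : Prop :=
  IsSink D i ∧ IsSink D j ∧ ∀ k ∈ between i j, ¬ IsSink D k

open Classical in
/-- The multiset of the numbers of vertices between consecutive sinks. -/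
def sinkGaps {n : ℕ} (D : Digraph (Fin n)) : Multiset ℕ :=
  (Finset.univ.filter fun p : Fin n × Fin n => ConsecutiveSinks D p.1 p.2).val.map
    fun p => (between p.1 p.2).card

open Classical in
/-- The acyclic orientations of the undirected cycle `C_n` for which the numbers of vertices between
consecutive sinks are `λ_1 - 1, …, λ_k - 1` in some order. -/
def acyclicOrientations {n : ℕ} (lam : n.Partition) : Finset (Digraph (Fin n)) :=
  {D | IsAcyclicOrientation (underlying (directedCycle n)) D ∧
    sinkGaps D = lam.parts.map fun a => a - 1}

end ChromaticDigraph

end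

/-!
In finitely many variables, a proper coloring of the cycle is a closed walk of length `n` in a
digraph of colors, so the chromatic quasisymmetric function becomes the trace of `M ^ n`, where
`M i j` is `t * x j` for `i < j`, `x j` for `i > j`, and `0` on the diagonal. By Newton's identities
this trace depends only on the reversed characteristic polynomial `det (1 - z M)`. A transition
matrix `T` with entries `0`, `e k`, `t` and `t * e k` has the same reversed characteristic
polynomial. Its states record the direction of the current edge and the number of steps since the
last sink, so the closed walks of `T` are the acyclic orientations of the cycle, and the weight of a
walk is `t ^ asc` times the product of the `e k` over the distances `k` between consecutive sinks.
Uniqueness of the coefficients is the algebraic independence of the elementary symmetric functions.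
-/

noncomputable section

namespace ChromaticDigraph

section Traces

open Matrix

open scoped PowerSeries

theorem derivation_prod {S A M ι : Type*} [CommSemiring S] [CommSemiring A] [Algebra S A]
    [AddCommMonoid M] [Module A M] [Module S M] [DecidableEq ι] (d : Derivation S A M)
    (s : Finset ι) (f : ι → A) :
    d (∏ i ∈ s, f i) = ∑ i ∈ s, (∏ j ∈ s.erase i, f j) • d (f i) := by
  induction s using Finset.induction with
  | empty => simp
  | insert a s ha ih =>
    rw [Finset.prod_insert ha, d.leibniz, ih, Finset.sum_insert ha, Finset.erase_insert ha,
      add_comm, Finset.smul_sum]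
    congr 1
    refine Finset.sum_congr rfl fun i hi => ?_
    have hai : a ≠ i := fun h => ha (h ▸ hi)
    rw [smul_smul, Finset.erase_insert_of_ne hai,
      Finset.prod_insert fun h => ha (Finset.mem_of_mem_erase h)]

variable {R : Type*} [CommRing R] {ι : Type*} [Fintype ι] [DecidableEq ι]

/- Jacobi's formula: the derivative of the determinant replaces one column at a time by its
derivative, and Cramer's rule expresses the resulting determinants through the adjugate. -/
theorem derivation_det {S : Type*} [CommSemiring S] [Algebra S R] (d : Derivation S R R)
    (B : Matrix ι ι R) : d B.det = (B.adjugate * B.map d).trace := by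
  have hcol (i : ι) : (B.adjugate * B.map d) i i = (B.updateCol i fun k => d (B k i)).det := by
    rw [← Matrix.cramer_apply, Matrix.cramer_eq_adjugate_mulVec]
    rfl
  simp only [Matrix.trace, Matrix.diag_apply, hcol, Matrix.det_apply', map_sum]
  rw [Finset.sum_comm]
  refine Finset.sum_congr rfl fun σ _ => ?_
  rw [← zsmul_eq_mul, map_zsmul, derivation_prod, Finset.smul_sum]
  refine Finset.sum_congr rfl fun i _ => ?_
  rw [smul_eq_mul, zsmul_eq_mul, ← Finset.prod_erase_mul _ _ (Finset.mem_univ i),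
    Matrix.updateCol_self]
  congr 2
  exact Finset.prod_congr rfl fun j hj => by
    rw [Matrix.updateCol_ne (Finset.ne_of_mem_erase hj)]

theorem coe_charpolyRev (M : Matrix ι ι R) : (M.charpolyRev : R⟦X⟧) =
    (1 - (PowerSeries.X : R⟦X⟧) • M.map PowerSeries.C).det := by
  rw [Matrix.charpolyRev, ← Polynomial.coeToPowerSeries.ringHom_apply, RingHom.map_det]
  congr 1
  ext1 i j
  by_cases hij : i = j <;> simp [hij, PowerSeries.X_mul]

theorem isUnit_coe_charpolyRev (M : Matrix ι ι R) : IsUnit (M.charpolyRev : R⟦X⟧) := by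
  rw [PowerSeries.isUnit_iff_constantCoeff, Polynomial.constantCoeff_coe,
    Polynomial.coeff_zero_eq_eval_zero, Matrix.eval_charpolyRev]
  exact isUnit_one

theorem charpolyRev_map {S : Type*} [CommRing S] (f : R →+* S) (M : Matrix ι ι R) :
    (M.map f).charpolyRev = M.charpolyRev.map f := by
  rw [Matrix.charpolyRev, Matrix.charpolyRev, ← Polynomial.coe_mapRingHom, RingHom.map_det]
  congr 1
  ext1 i j
  by_cases hij : i = j <;> simp [hij]

/-- The generating series `∑ n, Mⁿ Xⁿ` of the powers of a matrix, encoded as the matrix of the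
generating series of the entries. -/
def geometricSeries (M : Matrix ι ι R) : Matrix ι ι R⟦X⟧ :=
  Matrix.of fun i j => PowerSeries.mk fun n => (M ^ n) i j

theorem one_sub_mul_geometricSeries (M : Matrix ι ι R) :
    (1 - (PowerSeries.X : R⟦X⟧) • M.map PowerSeries.C) * geometricSeries M = 1 := by
  rw [sub_mul, one_mul]
  ext i j n
  rw [Matrix.sub_apply, map_sub, Matrix.smul_mul, Matrix.smul_apply, smul_eq_mul]
  rcases n with _ | n
  · by_cases hij : i = j <;> simp [geometricSeries, hij, Matrix.one_apply]
  · rw [PowerSeries.coeff_succ_X_mul, Matrix.mul_apply, map_sum]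
    simp only [geometricSeries, Matrix.of_apply, PowerSeries.coeff_mk, Matrix.map_apply,
      PowerSeries.coeff_C_mul, pow_succ', Matrix.mul_apply, sub_self]
    by_cases hij : i = j <;> simp [Matrix.one_apply, hij, PowerSeries.coeff_one]

/- Newton's identities: differentiate `det (1 - X M)` by Jacobi's formula and use that the adjugate
of `1 - X M` is `det (1 - X M) * ∑ n, Mⁿ Xⁿ`. -/
theorem charpolyRev_mul_mk_trace_pow (M : Matrix ι ι R) :
    (M.charpolyRev : R⟦X⟧) * PowerSeries.mk (fun n => (M ^ (n + 1)).trace) =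
      -PowerSeries.derivative R (M.charpolyRev : R⟦X⟧) := by
  set B : Matrix ι ι R⟦X⟧ := 1 - (PowerSeries.X : R⟦X⟧) • M.map PowerSeries.C with hB
  have hadj : B.adjugate = (M.charpolyRev : R⟦X⟧) • geometricSeries M := by
    calc B.adjugate = B.adjugate * B * geometricSeries M := by
          rw [mul_assoc, one_sub_mul_geometricSeries, mul_one]
      _ = _ := by rw [Matrix.adjugate_mul, coe_charpolyRev, Matrix.smul_mul, one_mul]
  have hder : B.map (PowerSeries.derivative R) = -M.map PowerSeries.C := by
    ext1 i j
    by_cases hij : i = j <;> simp [hij, hB, mul_comm]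
  have htrace : (geometricSeries M * M.map PowerSeries.C).trace =
      PowerSeries.mk fun n => (M ^ (n + 1)).trace := by
    ext n
    simp [Matrix.trace, Matrix.mul_apply, geometricSeries, pow_succ]
  calc _ = -(B.adjugate * B.map (PowerSeries.derivative R)).trace := by
        rw [hadj, hder, Matrix.mul_neg, Matrix.trace_neg, neg_neg, Matrix.smul_mul,
          Matrix.trace_smul, htrace, smul_eq_mul]
    _ = _ := by rw [← derivation_det, coe_charpolyRev]

theorem trace_pow_succ_eq_of_charpolyRev_eq {ι' : Type*} [Fintype ι'] [DecidableEq ι']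
    {M : Matrix ι ι R} {M' : Matrix ι' ι' R} (h : M.charpolyRev = M'.charpolyRev) (n : ℕ) :
    (M ^ (n + 1)).trace = (M' ^ (n + 1)).trace := by
  have hmk := charpolyRev_mul_mk_trace_pow M
  rw [h, ← charpolyRev_mul_mk_trace_pow M', (isUnit_coe_charpolyRev M').mul_right_inj] at hmk
  simpa only [PowerSeries.coeff_mk] using congrArg (PowerSeries.coeff n) hmk

theorem pow_succ_apply_eq_sum_walks (M : Matrix ι ι R) (n : ℕ) (a b : ι) :
    (M ^ (n + 1)) a b = ∑ κ : Fin n → ι, ∏ i : Fin (n + 1),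
      M (Fin.cons (α := fun _ => ι) a κ i) (Fin.snoc (α := fun _ => ι) κ b i) := by
  induction n generalizing a with
  | zero => simp [Fin.snoc]
  | succ n ih =>
    rw [pow_succ', Matrix.mul_apply, ← (Fin.consEquiv fun _ : Fin (n + 1) => ι).sum_comp,
      Fintype.sum_prod_type]
    refine Finset.sum_congr rfl fun c _ => ?_
    rw [ih, Finset.mul_sum]
    refine Finset.sum_congr rfl fun κ _ => ?_
    rw [Fin.prod_univ_succ (n := n + 1)]
    change _ = M a (Fin.snoc (α := fun _ => ι) (Fin.cons (α := fun _ => ι) c κ) b 0) *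
      ∏ i : Fin (n + 1), M (Fin.cons (α := fun _ => ι) c κ i)
        (Fin.snoc (α := fun _ => ι) (Fin.cons (α := fun _ => ι) c κ) b i.succ)
    rw [← Fin.cons_snoc_eq_snoc_cons]
    rfl

theorem trace_pow_succ_eq_sum_closed_walks (M : Matrix ι ι R) (n : ℕ) :
    (M ^ (n + 1)).trace = ∑ κ : Fin (n + 1) → ι, ∏ i, M (κ i) (κ (i + 1)) := by
  rw [← (Fin.consEquiv fun _ : Fin (n + 1) => ι).sum_comp, Fintype.sum_prod_type]
  refine Finset.sum_congr rfl fun a _ => ?_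
  rw [Matrix.diag_apply, pow_succ_apply_eq_sum_walks]
  refine Finset.sum_congr rfl fun κ _ => Finset.prod_congr rfl fun i _ => ?_
  rw [Fin.consEquiv_apply]
  congr 1
  induction i using Fin.lastCases with
  | last => simp
  | cast i => simp

end Traces

section ColorMatrix

open Matrix

variable {R : Type*} [CommRing R] {ι : Type*} [Fintype ι]

theorem det_add_smul_vecMulVec [DecidableEq ι] {A : Matrix ι ι R} (hA : IsUnit A.det) (t : R)
    (a b : ι → R) :
    (A + t • vecMulVec a b).det = A.det + t * ((A + vecMulVec a b).det - A.det) := by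
  have hdet (u : R) : (A + u • vecMulVec a b).det = A.det * (1 + u * (b ⬝ᵥ A⁻¹ *ᵥ a)) := by
    rw [← Matrix.smul_vecMulVec, Matrix.vecMulVec_eq Unit,
      Matrix.det_add_replicateCol_mul_replicateRow hA, Matrix.det_unique (n := Unit),
      Matrix.mul_assoc, Matrix.add_apply, Matrix.one_apply_eq, ← Matrix.replicateCol_mulVec,
      Matrix.mulVec_smul]
    exact congrArg _ (congrArg _ (dotProduct_smul u b _))
  have h1 := hdet 1
  rw [one_smul] at h1
  rw [h1, hdet]
  ring

theorem prod_one_add_mul_eq_sum_esymm (x : ι → R) (y : R) {K : ℕ} (hK : Fintype.card ι ≤ K) :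
    ∏ i, (1 + x i * y) =
      1 + ∑ k ∈ Finset.range K, (Finset.univ.val.map x).esymm (k + 1) * y ^ (k + 1) := by
  have hterm (k : ℕ) : ∑ s ∈ Finset.powersetCard k (Finset.univ : Finset ι), ∏ i ∈ s, x i * y =
      (Finset.univ.val.map x).esymm k * y ^ k := by
    rw [Finset.esymm_map_val, Finset.sum_mul]
    refine Finset.sum_congr rfl fun s hs => ?_
    rw [Finset.prod_mul_distrib, Finset.prod_const, (Finset.mem_powersetCard.1 hs).2]
  rw [Finset.prod_one_add, Finset.sum_powerset, Finset.sum_congr rfl fun k _ => hterm k,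
    Finset.card_univ, Finset.sum_range_succ', add_comm]
  congr 1
  · simp [Finset.esymm_map_val]
  · refine Finset.sum_subset (Finset.range_mono hK) fun k _ hk => ?_
    have hcard : Fintype.card ι < k + 1 := by simpa [Nat.lt_succ_iff] using hk
    rw [Finset.esymm_map_val, Finset.powersetCard_eq_empty.2 hcard, Finset.sum_empty, zero_mul]

theorem map_esymm {S : Type*} [CommRing S] (f : R →+* S) (x : ι → R) (k : ℕ) :
    f ((Finset.univ.val.map x).esymm k) = (Finset.univ.val.map fun i => f (x i)).esymm k := by
  simp only [Finset.esymm_map_val, map_sum, map_prod]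

/-- The sum of `t ^ f` over `1 ≤ f < k`: the generating function, by the number `f` of forward
edges, of the ways to orient the `k` edges between two consecutive sinks. -/
def arcWeight (t : R) (k : ℕ) : R := ∑ f ∈ Finset.Ico 1 k, t ^ f

theorem sub_one_mul_arcWeight_succ (t : R) (k : ℕ) :
    (t - 1) * arcWeight t (k + 1) = t ^ (k + 1) - t := by
  rw [arcWeight, mul_comm, geom_sum_Ico_mul _ (Nat.le_add_left 1 k), pow_one]

theorem map_arcWeight {S : Type*} [CommRing S] (f : R →+* S) (t : R) (k : ℕ) :
    f (arcWeight t k) = arcWeight (f t) k := by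
  simp only [arcWeight, map_sum, map_pow]

variable [LinearOrder ι]

/-- The weights of the steps from a colour `i` to a colour `j` in a closed walk of colours: `t` for
an ascent and `1` for a descent, times the variable of `j`. -/
def colorMatrix {ι : Type*} [LinearOrder ι] (t : R) (x : ι → R) : Matrix ι ι R :=
  Matrix.of fun i j => (if i < j then t else if j < i then 1 else 0) * x j

theorem colorMatrix_map {ι : Type*} [LinearOrder ι] {S : Type*} [CommRing S] (f : R →+* S) (t : R)
    (x : ι → R) : (colorMatrix t x).map f = colorMatrix (f t) (f ∘ x) := by
  ext i j
  simp [colorMatrix, apply_ite f]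

theorem det_one_sub_colorMatrix_add (t : R) (x : ι → R) :
    (1 - colorMatrix t x + vecMulVec 1 x).det = ∏ i, (1 + x i) := by
  rw [Matrix.det_of_isUpperTriangular]
  · simp [colorMatrix]
  · intro i j (hij : j < i)
    simp [colorMatrix, hij, hij.ne', hij.not_gt]

theorem det_one_sub_colorMatrix_add_smul (t : R) (x : ι → R) :
    (1 - colorMatrix t x + t • vecMulVec 1 x).det = ∏ i, (1 + t * x i) := by
  rw [Matrix.det_of_isLowerTriangular]
  · simp [colorMatrix]
  · intro i j (hij : i < j)
    simp [colorMatrix, hij, hij.ne]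

theorem sub_one_mul_det_one_sub_colorMatrix {t : R} {x : ι → R}
    (h : IsUnit (1 - colorMatrix t x).det) :
    (t - 1) * (1 - colorMatrix t x).det = t * ∏ i, (1 + x i) - ∏ i, (1 + t * x i) := by
  have hdet := det_add_smul_vecMulVec h t 1 x
  rw [det_one_sub_colorMatrix_add, det_one_sub_colorMatrix_add_smul] at hdet
  linear_combination hdet

open Polynomial

theorem C_sub_one_mul_charpolyRev_colorMatrix (t : R) (x : ι → R) :
    C (t - 1) * (colorMatrix t x).charpolyRev =
      C t * ∏ i, (1 + C (x i) * X) - ∏ i, (1 + C (x i) * (C t * X)) := by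
  apply Polynomial.coe_injective
  have hcoe (u : R[X]) : ((∏ i, (1 + C (x i) * u) : R[X]) : PowerSeries R) =
      ∏ i, (1 + PowerSeries.C (x i) * (u : PowerSeries R)) := by
    rw [← Polynomial.coeToPowerSeries.ringHom_apply, map_prod]
    simp
  have hM : (1 - (PowerSeries.X : PowerSeries R) • (colorMatrix t x).map PowerSeries.C) =
      1 - colorMatrix (PowerSeries.C t) fun i => PowerSeries.C (x i) * PowerSeries.X := by
    rw [colorMatrix_map]
    ext1 i j
    simp [colorMatrix, mul_assoc, PowerSeries.X_mul]
  have hunit := isUnit_coe_charpolyRev (colorMatrix t x)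
  rw [coe_charpolyRev, hM] at hunit
  rw [Polynomial.coe_sub, Polynomial.coe_mul, Polynomial.coe_mul, hcoe, hcoe, Polynomial.coe_mul,
    coe_charpolyRev, hM, Polynomial.coe_C, Polynomial.coe_C, Polynomial.coe_X, map_sub, map_one,
    sub_one_mul_det_one_sub_colorMatrix hunit]
  simp only [mul_left_comm]

theorem charpolyRev_colorMatrix_of_isLeftRegular {t : R} (ht : IsLeftRegular (t - 1)) (x : ι → R)
    {K : ℕ} (hK : Fintype.card ι ≤ K) :
    (colorMatrix t x).charpolyRev = 1 - ∑ k ∈ Finset.range K,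
      C ((Finset.univ.val.map x).esymm (k + 1) * arcWeight t (k + 1)) * X ^ (k + 1) := by
  have hmul : C (t - 1) * (colorMatrix t x).charpolyRev = C (t - 1) *
      (1 - ∑ k ∈ Finset.range K,
        C ((Finset.univ.val.map x).esymm (k + 1) * arcWeight t (k + 1)) * X ^ (k + 1)) := by
    rw [C_sub_one_mul_charpolyRev_colorMatrix,
      prod_one_add_mul_eq_sum_esymm (fun i => C (x i)) X hK,
      prod_one_add_mul_eq_sum_esymm (fun i => C (x i)) (C t * X) hK, mul_sub, mul_add, mul_one,
      mul_one, Finset.mul_sum, Finset.mul_sum, add_sub_add_comm, ← Finset.sum_sub_distrib, map_sub,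
      map_one, sub_eq_add_neg (C t - 1), ← Finset.sum_neg_distrib]
    congr 1
    refine Finset.sum_congr rfl fun k _ => ?_
    have h := congrArg (C : R → R[X]) (sub_one_mul_arcWeight_succ t k)
    simp only [map_mul, map_sub, map_one, map_pow, map_esymm] at h ⊢
    linear_combination (Finset.univ.val.map fun i => C (x i)).esymm (k + 1) * X ^ (k + 1) * h
  ext n
  apply ht
  simpa only [coeff_C_mul] using congrArg (coeff · n) hmul

/- For the variable `t` of a polynomial ring, `t - 1` can be cancelled; the general case is obtained
by specialization. -/
theorem charpolyRev_colorMatrix (t : R) (x : ι → R) {K : ℕ} (hK : Fintype.card ι ≤ K) :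
    (colorMatrix t x).charpolyRev = 1 - ∑ k ∈ Finset.range K,
      C ((Finset.univ.val.map x).esymm (k + 1) * arcWeight t (k + 1)) * X ^ (k + 1) := by
  have h := congrArg (mapRingHom (evalRingHom t)) (charpolyRev_colorMatrix_of_isLeftRegular
    (monic_X_sub_C (1 : R)).isRegular.left (fun i => C (x i)) hK)
  rw [coe_mapRingHom, ← charpolyRev_map, colorMatrix_map, ← coe_mapRingHom, map_sub, map_one,
    map_sum] at h
  simpa only [map_mul, map_pow, coe_mapRingHom, map_C, map_X, map_arcWeight, map_esymm,
    coe_evalRingHom, eval_X, eval_C, Function.comp_def] using h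

end ColorMatrix

section TransitionMatrix

open Matrix Polynomial

variable {R : Type*} [CommRing R] (K : ℕ) (t : R) (e : ℕ → R)

/-- The transition matrix of the automaton that reads the edges of a cyclic orientation. Its state
consists of the number of edges read since the last sink (before the current one) and the direction
of the current edge, with `true` for forward; a forward edge followed by a backward one meets in a
sink and completes an arc, which is weighted by `e` of its number of edges. -/
def transitionMatrix : Matrix (Fin K × Bool) (Fin K × Bool) R :=
  Matrix.of fun p q => if p.2 = true ∧ q.2 = false then
    if q.1.val = 0 then t * e (p.1 + 1) else 0
  else if q.1.val = p.1.val + 1 then if p.2 then t else 1 else 0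

/-- The part of `transitionMatrix` formed by the transitions that do not complete an arc. -/
def pushMatrix : Matrix (Fin K × Bool) (Fin K × Bool) R :=
  Matrix.of fun p q => if p.2 = true ∧ q.2 = false then 0
  else if q.1.val = p.1.val + 1 then if p.2 then t else 1 else 0

theorem charpolyRev_pushMatrix : (pushMatrix K t).charpolyRev = 1 := by
  have htriangular : (1 - (X : R[X]) • (pushMatrix K t).map C).BlockTriangular Prod.fst := by
    intro p q hqp
    have hpq : p ≠ q := fun h => hqp.ne (congrArg Prod.fst h.symm)
    have hstep : q.1.val ≠ p.1.val + 1 := by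
      rw [Fin.lt_def] at hqp
      omega
    simp [pushMatrix, hpq, hstep]
  rw [Matrix.charpolyRev, htriangular.det_fintype]
  refine Finset.prod_eq_one fun k _ => ?_
  suffices hblock : (1 - (X : R[X]) • (pushMatrix K t).map C).toSquareBlock Prod.fst k = 1 by
    rw [hblock, Matrix.det_one]
  ext1 p q
  obtain ⟨p, rfl⟩ := p
  obtain ⟨q, hq⟩ := q
  simp [Matrix.toSquareBlock_def, pushMatrix, hq, Matrix.one_apply]

/-- The total weight of the possible directions of the last `m` edges of an arc, if the first of
these `m` edges has direction `b`. -/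
def tailWeight (b : Bool) (m : ℕ) : R := if b then t ^ m else arcWeight t m

theorem tailWeight_true_succ (m : ℕ) : tailWeight t true (m + 1) = t * tailWeight t true m := by
  simp only [tailWeight, if_true, pow_succ']

theorem tailWeight_false_one : tailWeight t false 1 = 0 := by
  simp [tailWeight, arcWeight]

theorem tailWeight_false_add_two (m : ℕ) :
    tailWeight t false (m + 2) = tailWeight t true (m + 1) + tailWeight t false (m + 1) := by
  simp only [tailWeight, arcWeight, Bool.false_eq_true, if_false, if_true]
  rw [Finset.sum_Ico_succ_top (Nat.le_add_left 1 m), add_comm]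

/-- The generating polynomial of the ways to complete an arc from the state `(s, b)`, by the number
of further edges. -/
def completion (s : ℕ) (b : Bool) : R[X] :=
  ∑ m ∈ Finset.range (K - s), C (e (s + m + 1) * tailWeight t b (m + 1)) * X ^ m

theorem completion_true {s : ℕ} (hs : s < K) :
    completion K t e s true = C (t * e (s + 1)) + X * (C t * completion K t e (s + 1) true) := by
  obtain ⟨d, hd⟩ : ∃ d, K - s = d + 1 := Nat.exists_eq_succ_of_ne_zero (by omega)
  rw [completion, completion, hd, show K - (s + 1) = d by omega, Finset.sum_range_succ',
    Finset.mul_sum, Finset.mul_sum, add_comm (C _)]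
  refine congrArg₂ (· + ·) (Finset.sum_congr rfl fun m _ => ?_) ?_
  · rw [tailWeight_true_succ, add_right_comm s 1 m, ← add_assoc s m 1]
    simp only [map_mul]
    ring
  · simp [tailWeight, mul_comm]

theorem completion_false {s : ℕ} (hs : s < K) : completion K t e s false =
    X * (completion K t e (s + 1) true + completion K t e (s + 1) false) := by
  obtain ⟨d, hd⟩ : ∃ d, K - s = d + 1 := Nat.exists_eq_succ_of_ne_zero (by omega)
  rw [completion, completion, completion, hd, show K - (s + 1) = d by omega,
    Finset.sum_range_succ', tailWeight_false_one, mul_zero, map_zero, zero_mul, add_zero,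
    ← Finset.sum_add_distrib, Finset.mul_sum]
  refine Finset.sum_congr rfl fun m _ => ?_
  rw [tailWeight_false_add_two, add_right_comm s 1 m, ← add_assoc s m 1]
  simp only [map_mul, map_add]
  ring

theorem completion_of_le {s : ℕ} (hs : K ≤ s) (b : Bool) : completion K t e s b = 0 := by
  rw [completion, Nat.sub_eq_zero_of_le hs, Finset.sum_range_zero]

theorem sum_fin_ite_val_eq {A : Type*} [AddCommMonoid A] (K m : ℕ) (f : ℕ → A) :
    (∑ q : Fin K, if q.val = m then f q.val else 0) = if m < K then f m else 0 := by
  rw [Fin.sum_univ_eq_sum_range (fun q => if q = m then f q else 0) K, Finset.sum_ite_eq']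
  simp only [Finset.mem_range]

theorem sum_fin_ite_completion (s : ℕ) (b : Bool) :
    (∑ q : Fin K, if q.val = s then completion K t e q.val b else 0) = completion K t e s b := by
  rw [sum_fin_ite_val_eq K s fun q => completion K t e q b]
  exact ite_eq_left_iff.2 fun h => (completion_of_le K t e (not_lt.1 h) b).symm

theorem one_sub_pushMatrix_mulVec_completion :
    (1 - (X : R[X]) • (pushMatrix K t).map C) *ᵥ (fun q => completion K t e q.1 q.2) =
      fun p => C (if p.2 then t * e (p.1 + 1) else 0) := by
  funext ⟨s, b⟩
  rw [Matrix.sub_mulVec, Matrix.one_mulVec, Matrix.smul_mulVec, Pi.sub_apply, Pi.smul_apply,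
    smul_eq_mul, Matrix.mulVec, dotProduct, Fintype.sum_prod_type_right, Fintype.sum_bool]
  cases b
  · simp only [pushMatrix, Matrix.map_apply, Matrix.of_apply, Bool.false_eq_true, false_and,
      if_false, apply_ite C, map_zero, map_one, ite_mul, zero_mul, one_mul, sum_fin_ite_completion]
    rw [completion_false K t e s.isLt, sub_self]
  · simp only [pushMatrix, Matrix.map_apply, Matrix.of_apply, and_false, and_self, if_false,
      if_true, apply_ite C, map_zero, ite_mul, zero_mul, Finset.sum_const_zero, add_zero,
      Bool.true_eq_false]
    simp only [← mul_ite_zero, ← Finset.mul_sum, sum_fin_ite_completion]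
    rw [completion_true K t e s.isLt]
    ring

/- Completing an arc forgets the past: it leads to the state `(0, false)`, so these transitions form
a matrix of rank one. -/
theorem one_sub_transitionMatrix_eq_mul :
    1 - (X : R[X]) • (transitionMatrix K t e).map C =
      (1 - (X : R[X]) • (pushMatrix K t).map C) * (1 - (X : R[X]) •
        vecMulVec (fun q : Fin K × Bool => completion K t e q.1 q.2)
          fun q => if q.1.val = 0 ∧ q.2 = false then 1 else 0) := by
  rw [mul_sub, mul_one, Matrix.mul_smul, Matrix.mul_vecMulVec,
    one_sub_pushMatrix_mulVec_completion, sub_sub, ← smul_add]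
  congr 2
  ext1 ⟨s, b⟩ ⟨s', b'⟩
  cases b <;> cases b' <;> simp [transitionMatrix, pushMatrix, vecMulVec_apply, apply_ite C]

theorem charpolyRev_transitionMatrix : (transitionMatrix K t e).charpolyRev =
    1 - ∑ k ∈ Finset.range K, C (e (k + 1) * arcWeight t (k + 1)) * X ^ (k + 1) := by
  rw [Matrix.charpolyRev, one_sub_transitionMatrix_eq_mul, Matrix.det_mul, ← Matrix.charpolyRev,
    charpolyRev_pushMatrix, one_mul, ← Matrix.smul_vecMulVec, Matrix.vecMulVec_eq Unit,
    Matrix.det_one_sub_mul_comm, Matrix.det_unique (n := Unit), Matrix.sub_apply,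
    Matrix.one_apply_eq, Matrix.mul_apply, Fintype.sum_prod_type_right, Fintype.sum_bool]
  simp only [Matrix.replicateRow_apply, Matrix.replicateCol_apply, Pi.smul_apply, smul_eq_mul,
    Bool.true_eq_false, and_false, and_true, if_false, zero_mul, Finset.sum_const_zero, zero_add,
    ite_mul, one_mul]
  simp only [← mul_ite_zero, ← Finset.mul_sum, sum_fin_ite_completion]
  rw [completion, Finset.mul_sum, Nat.sub_zero]
  simp only [tailWeight, Bool.false_eq_true, if_false, zero_add, pow_succ', mul_left_comm X]

theorem charpolyRev_colorMatrix_eq_charpolyRev_transitionMatrix {ι : Type*} [Fintype ι]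
    [LinearOrder ι] (x : ι → R) {K : ℕ} (hK : Fintype.card ι ≤ K) :
    (colorMatrix t x).charpolyRev =
      (transitionMatrix K t (Finset.univ.val.map x).esymm).charpolyRev := by
  rw [charpolyRev_colorMatrix t x hK, charpolyRev_transitionMatrix]

end TransitionMatrix

section Cyclic

variable {n : ℕ}

theorem cyclic_induction {P : Fin (n + 1) → Prop} (i₀ : Fin (n + 1)) (h₀ : P i₀)
    (h : ∀ i, P i → P (i + 1)) (i : Fin (n + 1)) : P i := by
  have hshift (d : Fin (n + 1)) : P (d + i₀) := by
    induction d using Fin.induction with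
    | zero => rwa [zero_add]
    | succ d ih =>
      rw [← Fin.coeSucc_eq_succ, add_right_comm]
      exact h _ ih
  simpa only [sub_add_cancel] using hshift (i - i₀)

/-- The number of steps back from `i` to the nearest element of `S` around the circle `Fin (n + 1)`,
so that it is `0` for `i ∈ S`. It is only meaningful for nonempty `S`. -/
def distToLast (S : Finset (Fin (n + 1))) (i : Fin (n + 1)) : ℕ :=
  sInf {d | ∃ j ∈ S, (i - j).val = d}

variable {S : Finset (Fin (n + 1))}

theorem distToLast_le {j : Fin (n + 1)} (hj : j ∈ S) (i : Fin (n + 1)) :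
    distToLast S i ≤ (i - j).val :=
  Nat.sInf_le ⟨j, hj, rfl⟩

theorem exists_val_sub_eq_distToLast (hS : S.Nonempty) (i : Fin (n + 1)) :
    ∃ j ∈ S, (i - j).val = distToLast S i :=
  Nat.sInf_mem (s := {d | ∃ j ∈ S, (i - j).val = d}) (hS.elim fun j hj => ⟨_, j, hj, rfl⟩)

theorem distToLast_lt (hS : S.Nonempty) (i : Fin (n + 1)) : distToLast S i < n + 1 := by
  obtain ⟨j, -, hj⟩ := exists_val_sub_eq_distToLast hS i
  exact hj ▸ (i - j).isLt

theorem distToLast_of_mem {i : Fin (n + 1)} (hi : i ∈ S) : distToLast S i = 0 := by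
  simpa using distToLast_le hi i

theorem distToLast_succ_of_notMem (hS : S.Nonempty) {i : Fin (n + 1)} (hi : i + 1 ∉ S) :
    distToLast S (i + 1) = distToLast S i + 1 := by
  have hstep : ∀ j ∈ S, (i + 1 - j).val = (i - j).val + 1 := by
    intro j hj
    have hne : i + 1 - j ≠ 0 := fun h => hi (sub_eq_zero.1 h ▸ hj)
    have hpred := Fin.val_sub_one_of_ne_zero hne
    have hpos : 0 < (i + 1 - j).val := Fin.pos_iff_ne_zero.2 hne
    rw [show i + 1 - j - 1 = i - j by abel] at hpred
    omega
  apply le_antisymm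
  · obtain ⟨j, hj, hd⟩ := exists_val_sub_eq_distToLast hS i
    rw [← hd, ← hstep j hj]
    exact distToLast_le hj _
  · obtain ⟨j, hj, hd⟩ := exists_val_sub_eq_distToLast hS (i + 1)
    rw [← hd, hstep j hj]
    exact Nat.add_le_add_right (distToLast_le hj _) 1

theorem distToLast_succ (hS : S.Nonempty) (i : Fin (n + 1)) :
    distToLast S (i + 1) = if i + 1 ∈ S then 0 else distToLast S i + 1 := by
  split_ifs with hi
  · exact distToLast_of_mem hi
  · exact distToLast_succ_of_notMem hS hi

theorem nonempty_of_forall_succ_eq {s : Fin (n + 1) → ℕ}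
    (hs : ∀ i, s (i + 1) = if i + 1 ∈ S then 0 else s i + 1) : S.Nonempty := by
  by_contra! hS
  have hsum : ∑ i, s i = ∑ i, (s i + 1) :=
    calc ∑ i, s i = ∑ i, s (i + 1) :=
          (Equiv.sum_comp (Equiv.addRight (1 : Fin (n + 1))) s).symm
      _ = ∑ i, (s i + 1) := Finset.sum_congr rfl fun i _ => by simp [hs, hS]
  simp [Finset.sum_add_distrib] at hsum

theorem forall_succ_eq_iff {s : Fin (n + 1) → ℕ} :
    (∀ i, s (i + 1) = if i + 1 ∈ S then 0 else s i + 1) ↔ S.Nonempty ∧ s = distToLast S := by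
  constructor
  · intro hs
    have hS := nonempty_of_forall_succ_eq hs
    refine ⟨hS, ?_⟩
    obtain ⟨j, hj⟩ := hS
    have hsj : s j = 0 := by simpa [hj] using hs (j - 1)
    refine funext <| cyclic_induction j (hsj.trans (distToLast_of_mem hj).symm) fun i hi => ?_
    rw [hs, distToLast_succ ⟨j, hj⟩, hi]
  · rintro ⟨hS, rfl⟩
    exact distToLast_succ hS

/-- The multiset of the lengths of the arcs into which the points of `S` divide the circle. -/
def arcLengths (S : Finset (Fin (n + 1))) : Multiset ℕ :=
  S.val.map fun j => distToLast S (j - 1) + 1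

theorem sum_arcLengths (hS : S.Nonempty) : (arcLengths S).sum = n + 1 := by
  have hstep (i : Fin (n + 1)) :
      distToLast S i + (if i ∈ S then distToLast S (i - 1) + 1 else 0) =
        distToLast S (i - 1) + 1 := by
    have h := distToLast_succ hS (i - 1)
    rw [sub_add_cancel] at h
    split_ifs at h ⊢ <;> omega
  have hsum := Finset.sum_congr rfl fun i (_ : i ∈ Finset.univ) => hstep i
  have hshift : ∑ i, distToLast S (i - 1) = ∑ i, distToLast S i :=
    Equiv.sum_comp (Equiv.subRight (1 : Fin (n + 1))) (distToLast S)
  rw [Finset.sum_add_distrib, Finset.sum_add_distrib, hshift, Finset.sum_ite_mem,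
    Finset.univ_inter] at hsum
  exact (Nat.add_left_cancel hsum).trans (by simp)

/-- The partition of `n + 1` formed by the lengths of the arcs between the points of `S`. -/
def arcPartition (hS : S.Nonempty) : (n + 1).Partition where
  parts := arcLengths S
  parts_pos := by
    intro k hk
    obtain ⟨j, -, rfl⟩ := Multiset.mem_map.1 hk
    exact Nat.succ_pos _
  parts_sum := sum_arcLengths hS

/-- The positions `i` at which the cyclic word `ε` of edge directions has a sink: the edge from
`i - 1` to `i` is directed forward (`ε (i - 1) = true`), the one from `i` to `i + 1` backward. -/
def turns (ε : Fin (n + 1) → Bool) : Finset (Fin (n + 1)) :=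
  {i | ε (i - 1) = true ∧ ε i = false}

/-- The weight of a cyclic word of edge directions: `t` for each forward edge, and `e k` for each
arc of length `k` between consecutive sinks. -/
def turnWeight {R : Type*} [CommRing R] (t : R) (e : ℕ → R) (ε : Fin (n + 1) → Bool) : R :=
  (∏ i, if ε i then t else 1) * ((arcLengths (turns ε)).map e).prod

variable {R : Type*} [CommRing R] {K : ℕ} (t : R) (e : ℕ → R) (ε : Fin (n + 1) → Bool)

theorem prod_transitionMatrix (s : Fin (n + 1) → Fin K) :
    ∏ i, transitionMatrix K t e (s i, ε i) (s (i + 1), ε (i + 1)) =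
      if (turns ε).Nonempty ∧ (fun i => (s i).val) = distToLast (turns ε) then
        turnWeight t e ε else 0 := by
  simp only [← forall_succ_eq_iff]
  split_ifs with h
  · have hs := (forall_succ_eq_iff (s := fun i => (s i).val).1 h).2
    rw [turnWeight, arcLengths, Multiset.map_map, Finset.prod_map_val,
      ← Finset.univ_inter (turns ε), ← Finset.prod_ite_mem,
      ← Equiv.prod_comp (Equiv.addRight (1 : Fin (n + 1))) fun j => ite (j ∈ turns ε) _ _,
      ← Finset.prod_mul_distrib]
    refine Finset.prod_congr rfl fun i _ => ?_
    have hi := h i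
    have hd := congrFun hs i
    simp only [transitionMatrix, Matrix.of_apply, Equiv.coe_addRight, turns, Finset.mem_filter_univ,
      add_sub_cancel_right, Function.comp_apply] at hi hd ⊢
    split_ifs at hi ⊢ <;> simp_all
  · obtain ⟨i, hi⟩ := not_forall.1 h
    refine Finset.prod_eq_zero (Finset.mem_univ i) ?_
    simp only [transitionMatrix, Matrix.of_apply, turns, Finset.mem_filter_univ,
      add_sub_cancel_right] at hi ⊢
    split_ifs at hi ⊢ <;> simp_all

theorem trace_transitionMatrix_pow (hK : n + 1 ≤ K) :
    (transitionMatrix K t e ^ (n + 1)).trace =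
      ∑ ε : Fin (n + 1) → Bool with (turns ε).Nonempty, turnWeight t e ε := by
  rw [trace_pow_succ_eq_sum_closed_walks,
    ← (Equiv.arrowProdEquivProdArrow (Fin (n + 1)) (fun _ => Fin K) fun _ => Bool).symm.sum_comp,
    Fintype.sum_prod_type_right, Finset.sum_filter]
  refine Finset.sum_congr rfl fun ε _ => ?_
  simp only [Equiv.arrowProdEquivProdArrow, Equiv.coe_fn_symm_mk, prod_transitionMatrix]
  split_ifs with h
  · rw [Finset.sum_eq_single fun i => ⟨distToLast (turns ε) i, (distToLast_lt h i).trans_le hK⟩]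
    · exact if_pos ⟨h, rfl⟩
    · exact fun s _ hs => if_neg fun hs' => hs (funext fun i => Fin.ext (congrFun hs'.2 i))
    · exact fun h => absurd (Finset.mem_univ _) h
  · exact Finset.sum_eq_zero fun s _ => if_neg fun hs => h hs.1

end Cyclic

section Sinks

variable {n : ℕ}

theorem ite_eq_val_sub_one_sub_add_one (i j : Fin (n + 1)) :
    (if i = j then n + 1 else (j - i).val) = (j - 1 - i).val + 1 := by
  rw [sub_right_comm]
  split_ifs with h
  · rw [h, sub_self, zero_sub, Fin.coe_neg_one]
  · have hne : j - i ≠ 0 := fun h0 => h (sub_eq_zero.1 h0).symm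
    have hpos : 0 < (j - i).val := Fin.pos_iff_ne_zero.2 hne
    rw [Fin.val_sub_one_of_ne_zero hne]
    omega

theorem mem_between {i j k : Fin (n + 1)} : k ∈ between i j ↔ 0 < k - i ∧ k - i ≤ j - 1 - i := by
  rw [between, Finset.mem_filter_univ, ite_eq_val_sub_one_sub_add_one, Nat.lt_succ_iff]
  rfl

theorem card_between (i j : Fin (n + 1)) : (between i j).card = (j - 1 - i).val := by
  have hmap : between i j = (Finset.Ioc 0 (j - 1 - i)).map (Equiv.addRight i).toEmbedding := by
    ext k
    rw [mem_between, Finset.mem_map_equiv, Finset.mem_Ioc, Equiv.addRight_symm]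
    simp only [Equiv.coe_addRight, sub_eq_add_neg]
  rw [hmap, Finset.card_map, Fin.card_Ioc, Fin.val_zero, Nat.sub_zero]

theorem val_sub_sub_of_le {a b c : Fin (n + 1)} (h : b - c ≤ a - c) :
    (a - b).val = (a - c).val - (b - c).val := by
  rw [← Fin.sub_val_of_le h, sub_sub_sub_cancel_right]

variable {D : Digraph (Fin (n + 1))} {S : Finset (Fin (n + 1))}

theorem consecutiveSinks_iff (hD : ∀ v, IsSink D v ↔ v ∈ S) (i j : Fin (n + 1)) :
    ConsecutiveSinks D i j ↔ i ∈ S ∧ j ∈ S ∧ (j - 1 - i).val = distToLast S (j - 1) := by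
  simp only [ConsecutiveSinks, hD]
  refine and_congr_right fun hi => and_congr_right fun _ => ⟨fun h => ?_, fun h k hk hk' => ?_⟩
  · obtain ⟨k, hk, hd⟩ := exists_val_sub_eq_distToLast ⟨i, hi⟩ (j - 1)
    refine le_antisymm (le_of_not_gt fun hlt => ?_) (distToLast_le hi _)
    rw [← hd] at hlt
    have hki : k - i = (j - 1 - i) - (j - 1 - k) := by abel
    have hval := Fin.sub_val_of_le (Fin.le_def.2 hlt.le)
    rw [← hki] at hval
    refine h k (mem_between.2 ?_) hk
    rw [Fin.lt_def, Fin.le_def, hval, Fin.val_zero]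
    omega
  · rw [mem_between] at hk
    have hval := val_sub_sub_of_le hk.2
    have hle := distToLast_le hk' (j - 1)
    rw [Fin.lt_def, Fin.le_def, Fin.val_zero] at hk
    omega

theorem sinkGaps_eq_map_distToLast (hS : S.Nonempty) (hD : ∀ v, IsSink D v ↔ v ∈ S) :
    sinkGaps D = S.val.map fun j => distToLast S (j - 1) := by
  classical
  choose prev hprev hdist using fun j => exists_val_sub_eq_distToLast hS (j - 1)
  have hpairs : Finset.univ.filter (fun p : Fin (n + 1) × Fin (n + 1) =>
      ConsecutiveSinks D p.1 p.2) =
      S.map ⟨fun j => (prev j, j), fun _ _ hab => (Prod.ext_iff.1 hab).2⟩ := by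
    ext ⟨i, j⟩
    simp only [Finset.mem_filter_univ, Finset.mem_map, consecutiveSinks_iff hD]
    constructor
    · rintro ⟨-, hj, hd⟩
      rw [← hdist] at hd
      exact ⟨j, hj, Prod.ext (sub_right_injective (Fin.ext hd)).symm rfl⟩
    · rintro ⟨j, hj, ⟨⟩⟩
      exact ⟨hprev _, hj, hdist _⟩
  rw [sinkGaps, hpairs, Finset.map_val, Multiset.map_map]
  exact Multiset.map_congr rfl fun j _ => (card_between _ _).trans (hdist j)

theorem sinkGaps_eq_map_pred_iff (hS : S.Nonempty) (hD : ∀ v, IsSink D v ↔ v ∈ S)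
    (lam : (n + 1).Partition) :
    sinkGaps D = lam.parts.map (fun a => a - 1) ↔ arcPartition hS = lam := by
  have hgaps : (arcLengths S).map (fun a => a - 1) = sinkGaps D := by
    rw [sinkGaps_eq_map_distToLast hS hD, arcLengths, Multiset.map_map]
    rfl
  have hsucc (mu : (n + 1).Partition) : (mu.parts.map fun a => a - 1).map (· + 1) = mu.parts := by
    rw [Multiset.map_map]
    exact (Multiset.map_congr rfl fun a ha => Nat.sub_add_cancel (mu.parts_pos ha)).trans
      (Multiset.map_id _)
  rw [← hgaps, Nat.Partition.ext_iff]
  refine ⟨fun h => ?_, fun h => congrArg _ h⟩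
  rw [← hsucc lam, ← h]
  exact (hsucc (arcPartition hS)).symm

end Sinks

section Orientation

variable {n : ℕ}

theorem directedCycle_adj {u v : Fin (n + 1)} : (directedCycle (n + 1)).Adj u v ↔ v = u + 1 := by
  change (u.val + 1 = v.val ∨ (u.val + 1 = n + 1 ∧ v.val = 0)) ↔ _
  rw [Fin.ext_iff, Fin.val_add_one]
  split_ifs with hu <;> rw [Fin.ext_iff, Fin.val_last] at hu <;> omega

theorem underlying_directedCycle_adj {u v : Fin (n + 2)} :
    (underlying (directedCycle (n + 2))).Adj u v ↔ v = u + 1 ∨ u = v + 1 := by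
  rw [underlying, Digraph.toSimpleGraphInclusive, SimpleGraph.fromRel_adj, directedCycle_adj,
    directedCycle_adj]
  refine and_iff_right_of_imp ?_
  rintro h rfl
  simp at h

theorem ncard_directedCycle_adj_and (P : Fin (n + 1) → Fin (n + 1) → Prop)
    [DecidablePred fun i => P i (i + 1)] :
    {p : Fin (n + 1) × Fin (n + 1) | (directedCycle (n + 1)).Adj p.1 p.2 ∧ P p.1 p.2}.ncard =
      Finset.card {i | P i (i + 1)} := by
  have himage : {p : Fin (n + 1) × Fin (n + 1) |
      (directedCycle (n + 1)).Adj p.1 p.2 ∧ P p.1 p.2} =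
      (fun i => (i, i + 1)) '' {i | P i (i + 1)} := by
    ext ⟨u, v⟩
    simp only [Set.mem_ofPred_eq, directedCycle_adj, Set.mem_image, Prod.mk.injEq]
    grind
  rw [himage, Set.ncard_image_of_injective _ fun a b hab => (Prod.ext_iff.1 hab).1,
    ← Set.ncard_coe_finset, Finset.coe_filter_univ]

/-- The orientation of the cycle in which the edge between `i` and `i + 1` points to `i + 1` if
`ε i = true` and to `i` if `ε i = false`. -/
def orientation (ε : Fin (n + 1) → Bool) : Digraph (Fin (n + 1)) where
  Adj u v := (v = u + 1 ∧ ε u = true) ∨ (u = v + 1 ∧ ε v = false)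

variable {ε : Fin (n + 1) → Bool}

theorem isSink_orientation (v : Fin (n + 1)) : IsSink (orientation ε) v ↔ v ∈ turns ε := by
  rw [turns, Finset.mem_filter_univ]
  constructor
  · refine fun h => ⟨?_, ?_⟩
    · by_contra hε
      exact h (v - 1) (.inr ⟨(sub_add_cancel _ _).symm, by simpa using hε⟩)
    · by_contra hε
      exact h (v + 1) (.inl ⟨rfl, by simpa using hε⟩)
  · rintro ⟨hpred, hv⟩ w (⟨-, hv'⟩ | ⟨rfl, hw⟩)
    · simp [hv] at hv'
    · rw [add_sub_cancel_right] at hpred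
      simp [hw] at hpred

/-- This only occurs on a circle with the two vertices `u` and `v`. -/
theorem eq_not_of_eq_add_one (hε : (turns ε).Nonempty) {u v : Fin (n + 1)} (huv : v = u + 1)
    (hvu : u = v + 1) : ε v = !ε u := by
  have htwo : ∀ i, i = u ∨ i = v := cyclic_induction u (.inl rfl) <| by
    rintro i (rfl | rfl)
    · exact .inr huv.symm
    · exact .inl hvu.symm
  have hu : u - 1 = v := sub_eq_of_eq_add hvu
  have hv : v - 1 = u := sub_eq_of_eq_add huv
  obtain ⟨j, hj⟩ := hε
  rw [turns, Finset.mem_filter_univ] at hj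
  rcases htwo j with rfl | rfl
  · rw [hu] at hj
    simp [hj]
  · rw [hv] at hj
    simp [hj]

theorem orientation_adj_add_one (hε : (turns ε).Nonempty) (i : Fin (n + 1)) :
    (orientation ε).Adj i (i + 1) ↔ ε i = true := by
  refine ⟨?_, fun h => .inl ⟨rfl, h⟩⟩
  rintro (⟨-, h⟩ | ⟨hi, h⟩)
  · exact h
  · simpa [h] using eq_not_of_eq_add_one hε rfl hi

theorem orientation_antisymm (hε : (turns ε).Nonempty) (u v : Fin (n + 1))
    (huv : (orientation ε).Adj u v) : ¬(orientation ε).Adj v u := by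
  rcases huv with ⟨rfl, hu⟩ | ⟨rfl, hv⟩
  · rintro (⟨h, hv⟩ | ⟨-, hu'⟩)
    · simpa [hu, hv] using eq_not_of_eq_add_one hε rfl h
    · simp [hu] at hu'
  · rw [orientation_adj_add_one hε, hv]
    exact Bool.false_ne_true

theorem transGen_orientation_add_one (hε : (turns ε).Nonempty) {v : Fin (n + 1)}
    (hv : Relation.TransGen (orientation ε).Adj v v) :
    Relation.TransGen (orientation ε).Adj (v + 1) (v + 1) := by
  -- The neighbours of `v` on a closed walk are distinct, so one of them is `v + 1`.
  obtain ⟨w, hvw, hwv⟩ := Relation.TransGen.head'_iff.1 hv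
  obtain ⟨u, hvu, huv⟩ := Relation.TransGen.tail'_iff.1 hv
  have hw := Relation.TransGen.tail' hwv hvw
  have hu := Relation.TransGen.head' huv hvu
  rcases id hvw with ⟨rfl, -⟩ | ⟨hw', -⟩
  · exact hw
  rcases id huv with ⟨hu', -⟩ | ⟨rfl, -⟩
  · obtain rfl : u = w := add_right_cancel (hu'.symm.trans hw')
    exact absurd hvw (orientation_antisymm hε _ _ huv)
  · exact hu

theorem not_transGen_orientation_self (hε : (turns ε).Nonempty) (v : Fin (n + 1)) :
    ¬Relation.TransGen (orientation ε).Adj v v := by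
  intro hv
  obtain ⟨j, hj⟩ := hε
  have hjj := cyclic_induction (P := fun i => Relation.TransGen (orientation ε).Adj i i) v hv
    (fun _ => transGen_orientation_add_one ⟨j, hj⟩) j
  obtain ⟨w, hjw, -⟩ := Relation.TransGen.head'_iff.1 hjj
  exact (isSink_orientation j).2 hj w hjw

theorem transGen_self_of_forall_add_one {r : Fin (n + 1) → Fin (n + 1) → Prop}
    (hr : ∀ i, r i (i + 1)) (i : Fin (n + 1)) : Relation.TransGen r i i :=
  cyclic_induction (P := Relation.TransGen r i) (i + 1) (.single (hr i))
    (fun j hj => hj.tail (hr j)) i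

theorem turns_nonempty_of_acyclic (h : ∀ v, ¬Relation.TransGen (orientation ε).Adj v v) :
    (turns ε).Nonempty := by
  by_contra! hturns
  have hstep (i : Fin (n + 1)) (hi : ε i = true) : ε (i + 1) = true := by
    by_contra hi'
    have hmem : i + 1 ∈ turns ε := by
      rw [turns, Finset.mem_filter_univ, add_sub_cancel_right]
      exact ⟨hi, by simpa using hi'⟩
    simp [hturns] at hmem
  by_cases hforward : ∃ i, ε i = true
  · obtain ⟨i₀, hi₀⟩ := hforward
    have hall := cyclic_induction i₀ hi₀ hstep
    exact h 0 (transGen_self_of_forall_add_one (fun i => .inl ⟨rfl, hall i⟩) 0)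
  · have hall : ∀ i, ε i = false := by simpa using hforward
    refine h 0 (Relation.transGen_swap.1 ?_)
    exact transGen_self_of_forall_add_one (fun i => .inr ⟨rfl, hall i⟩) 0

theorem isAcyclicOrientation_orientation {ε : Fin (n + 2) → Bool} (hε : (turns ε).Nonempty) :
    IsAcyclicOrientation (underlying (directedCycle (n + 2))) (orientation ε) where
  adj_iff u v := by
    change _ ↔ (v = u + 1 ∧ ε u = true ∨ u = v + 1 ∧ ε v = false) ∨
      (u = v + 1 ∧ ε v = true ∨ v = u + 1 ∧ ε u = false)
    rw [underlying_directedCycle_adj]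
    cases ε u <;> cases ε v <;> simp [or_comm]
  antisymm := orientation_antisymm hε
  acyclic := not_transGen_orientation_self hε

open Classical in
theorem orientation_decide_adj_add_one {D : Digraph (Fin (n + 2))}
    (hD : IsAcyclicOrientation (underlying (directedCycle (n + 2))) D) :
    orientation (fun i => decide (D.Adj i (i + 1))) = D := by
  ext u v
  have hiff := hD.adj_iff u v
  rw [underlying_directedCycle_adj] at hiff
  simp only [orientation, decide_eq_true_eq, decide_eq_false_iff_not]
  constructor
  · rintro (⟨rfl, h⟩ | ⟨rfl, h⟩)
    · exact h
    · exact (hiff.1 (.inr rfl)).resolve_right h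
  · intro h
    rcases hiff.2 (.inl h) with rfl | rfl
    · exact .inl ⟨rfl, h⟩
    · exact .inr ⟨rfl, hD.antisymm _ _ h⟩

theorem bijOn_orientation : Set.BijOn orientation {ε : Fin (n + 2) → Bool | (turns ε).Nonempty}
    {D | IsAcyclicOrientation (underlying (directedCycle (n + 2))) D} := by
  classical
  refine ⟨fun ε hε => isAcyclicOrientation_orientation hε, fun ε hε ε' hε' h => ?_, fun D hD => ?_⟩
  · ext1 i
    rw [Bool.eq_iff_iff, ← orientation_adj_add_one hε, ← orientation_adj_add_one hε', h]
  · have hD' := orientation_decide_adj_add_one hD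
    refine ⟨_, turns_nonempty_of_acyclic ?_, hD'⟩
    rw [hD']
    exact hD.acyclic

theorem bijOn_orientation_acyclicOrientations (lam : (n + 2).Partition) :
    Set.BijOn orientation
      {ε : Fin (n + 2) → Bool | ∃ hε : (turns ε).Nonempty, arcPartition hε = lam}
      (acyclicOrientations lam) := by
  have hgaps {ε : Fin (n + 2) → Bool} (hε : (turns ε).Nonempty) :=
    sinkGaps_eq_map_pred_iff hε isSink_orientation lam
  simp only [acyclicOrientations, Finset.coe_filter_univ]
  refine ⟨fun ε ⟨hε, h⟩ => ⟨bijOn_orientation.mapsTo hε, (hgaps hε).2 h⟩,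
    bijOn_orientation.injOn.mono fun ε ⟨hε, _⟩ => hε, fun D ⟨hD, h⟩ => ?_⟩
  obtain ⟨ε, hε, rfl⟩ := bijOn_orientation.surjOn hD
  exact ⟨ε, ⟨hε, (hgaps hε).1 h⟩, rfl⟩

variable {R : Type*} [CommRing R] (t : R) (e : ℕ → R)

theorem turnWeight_eq_pow_orientationAsc_mul (hε : (turns ε).Nonempty) :
    turnWeight t e ε = t ^ orientationAsc (directedCycle (n + 1)) (orientation ε) *
      ((arcPartition hε).parts.map e).prod := by
  classical
  rw [turnWeight, orientationAsc, ncard_directedCycle_adj_and]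
  simp only [orientation_adj_add_one hε, ← Finset.prod_const, Finset.prod_filter]
  rfl

theorem sum_acyclicOrientations :
    ∑ lam : (n + 2).Partition, (∑ D ∈ acyclicOrientations lam,
      t ^ orientationAsc (directedCycle (n + 2)) D) * (lam.parts.map e).prod =
    ∑ ε : Fin (n + 2) → Bool with (turns ε).Nonempty, turnWeight t e ε := by
  classical
  have hfiber (lam : (n + 2).Partition) :
      (∑ D ∈ acyclicOrientations lam, t ^ orientationAsc (directedCycle (n + 2)) D) *
        (lam.parts.map e).prod =
      ∑ ε : Fin (n + 2) → Bool with ∃ hε : (turns ε).Nonempty, arcPartition hε = lam,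
        turnWeight t e ε := by
    have hbij := bijOn_orientation_acyclicOrientations lam
    rw [← Finset.coe_filter_univ] at hbij
    rw [Finset.sum_mul]
    refine (Finset.sum_nbij orientation hbij.mapsTo hbij.injOn hbij.surjOn fun ε hε => ?_).symm
    obtain ⟨hturns, rfl⟩ := (Finset.mem_filter_univ _).1 hε
    exact turnWeight_eq_pow_orientationAsc_mul t e hturns
  simp only [hfiber, Finset.sum_filter]
  rw [Finset.sum_comm]
  refine Finset.sum_congr rfl fun ε _ => ?_
  by_cases hε : (turns ε).Nonempty <;> simp [hε]

end Orientation

section Restriction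

/-- Setting all variables outside of `s` to zero. -/
abbrev restrict (s : Finset ℕ+) : MvPowerSeries ℕ+ ℚ[X] →ₐ[ℚ[X]] MvPowerSeries s ℚ[X] :=
  MvPowerSeries.killCompl (Function.Embedding.subtype (· ∈ s))

theorem eq_of_restrict_eq {f g : MvPowerSeries ℕ+ ℚ[X]} (h : ∀ s, restrict s f = restrict s g) :
    f = g := by
  ext1 m
  obtain ⟨x, hx⟩ : m ∈ Set.range (Finsupp.embDomain (M := ℕ)
      (Function.Embedding.subtype (· ∈ m.support))) :=
    (Finsupp.mem_range_embDomain_iff _ _).2 fun i hi => ⟨⟨i, hi⟩, rfl⟩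
  have hcoeff := congrArg (MvPowerSeries.coeff x) (h m.support)
  rwa [MvPowerSeries.coeff_killCompl, MvPowerSeries.coeff_killCompl, hx] at hcoeff

theorem le_one_and_degree_eq_iff {σ : Type*} [Fintype σ] (x : σ →₀ ℕ) (k : ℕ) :
    ((∀ i, x i ≤ 1) ∧ x.degree = k) ↔
      ∃ T ∈ Finset.powersetCard k (Finset.univ : Finset σ), ∑ i ∈ T, Finsupp.single i 1 = x := by
  classical
  constructor
  · rintro ⟨hx, rfl⟩
    have hone : ∀ i ∈ x.support, x i = 1 := fun i hi =>
      le_antisymm (hx i) (Nat.pos_of_ne_zero (Finsupp.mem_support_iff.1 hi))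
    refine ⟨x.support, Finset.mem_powersetCard.2 ⟨Finset.subset_univ _, ?_⟩, ?_⟩
    · rw [Finsupp.degree_apply, Finset.sum_congr rfl hone, Finset.sum_const, smul_eq_mul, mul_one]
    · conv_rhs => rw [← Finsupp.sum_single x, Finsupp.sum]
      exact Finset.sum_congr rfl fun i hi => by rw [hone i hi]
  · rintro ⟨T, hT, rfl⟩
    refine ⟨fun i => ?_, ?_⟩
    · simp only [Finsupp.finsetSum_apply, Finsupp.single_apply, Finset.sum_ite_eq']
      split_ifs <;> simp
    · rw [map_sum]
      simp [(Finset.mem_powersetCard.1 hT).2]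

theorem sum_single_one_injective {σ : Type*} :
    Function.Injective fun T : Finset σ => ∑ i ∈ T, Finsupp.single i 1 := by
  classical
  intro S T h
  ext i
  have hi := DFunLike.congr_fun h i
  simp only [Finsupp.finsetSum_apply, Finsupp.single_apply, Finset.sum_ite_eq'] at hi
  split_ifs at hi <;> simp_all

theorem coeff_esymm {σ R : Type*} [Fintype σ] [CommSemiring R] (x : σ →₀ ℕ) (k : ℕ)
    [Decidable ((∀ i, x i ≤ 1) ∧ x.degree = k)] :
    (MvPolynomial.esymm σ R k).coeff x = if (∀ i, x i ≤ 1) ∧ x.degree = k then 1 else 0 := by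
  classical
  rw [MvPolynomial.esymm_eq_sum_monomial, MvPolynomial.coeff_sum]
  simp only [MvPolynomial.coeff_monomial, le_one_and_degree_eq_iff]
  split_ifs with h
  · obtain ⟨T, hT, rfl⟩ := h
    rw [Finset.sum_eq_single_of_mem T hT fun S _ hne =>
      if_neg fun h => hne (sum_single_one_injective h), if_pos rfl]
  · exact Finset.sum_eq_zero fun T hT => if_neg fun hx => h ⟨T, hT, hx⟩

theorem embDomain_le_one_iff {σ τ : Type*} (f : σ ↪ τ) (x : σ →₀ ℕ) :
    (∀ i, x.embDomain f i ≤ 1) ↔ ∀ i, x i ≤ 1 := by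
  refine ⟨fun h i => Finsupp.embDomain_apply_self f x i ▸ h (f i), fun h i => ?_⟩
  by_cases hi : i ∈ Set.range f
  · obtain ⟨i, rfl⟩ := hi
    rw [Finsupp.embDomain_apply_self]
    exact h i
  · rw [Finsupp.embDomain_of_notMem_range _ _ _ hi]
    exact zero_le_one

theorem restrict_elementary (s : Finset ℕ+) (k : ℕ) :
    restrict s (elementary k) = (MvPolynomial.esymm s ℚ[X] k : MvPowerSeries s ℚ[X]) := by
  classical
  ext1 x
  rw [MvPowerSeries.coeff_killCompl, MvPolynomial.coeff_coe, coeff_esymm]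
  refine if_congr (and_congr (embDomain_le_one_iff _ x) ?_) rfl rfl
  rw [Finsupp.embDomain_eq_mapDomain, Finsupp.degree_mapDomain]

theorem restrict_elementaryPart (s : Finset ℕ+) {n : ℕ} (lam : n.Partition) :
    restrict s (elementaryPart lam) =
      (MvPolynomial.esymmPart s ℚ[X] lam : MvPowerSeries s ℚ[X]) := by
  rw [elementaryPart, MvPolynomial.esymmPart, map_multiset_prod, Multiset.map_map,
    ← MvPolynomial.coeToMvPowerSeries.ringHom_apply, map_multiset_prod, Multiset.map_map]
  exact congrArg _ (Multiset.map_congr rfl fun k _ => restrict_elementary s k)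

theorem restrict_sum_smul_elementaryPart (s : Finset ℕ+) {n : ℕ} (c : n.Partition → ℚ[X]) :
    restrict s (∑ lam, c lam • elementaryPart lam) =
      (∑ lam, c lam • MvPolynomial.esymmPart s ℚ[X] lam : MvPolynomial s ℚ[X]) := by
  rw [map_sum, ← MvPolynomial.coeToMvPowerSeries.ringHom_apply, map_sum]
  refine Finset.sum_congr rfl fun lam _ => ?_
  rw [map_smul, restrict_elementaryPart, MvPolynomial.coeToMvPowerSeries.ringHom_apply,
    MvPolynomial.coe_smul]

end Restriction

section Independence

theorem monomial_toFinsupp_one {σ R : Type*} [CommSemiring R] [DecidableEq σ] (M : Multiset σ) :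
    MvPolynomial.monomial (R := R) (Multiset.toFinsupp M) 1 = (M.map MvPolynomial.X).prod := by
  induction M using Multiset.induction with
  | empty => simp
  | cons a M ih =>
    rw [Multiset.map_cons, Multiset.prod_cons, ← ih, ← Multiset.singleton_add, map_add,
      Multiset.toFinsupp_singleton, MvPolynomial.X, MvPolynomial.monomial_mul, one_mul]

/-- The exponent vector with which the variable for `e_{i + 1}` has the multiplicity of `i + 1` in
`lam` as its exponent. -/
def partExponents {n : ℕ} (lam : n.Partition) : Fin n →₀ ℕ :=
  Multiset.toFinsupp <| lam.parts.attach.map fun a =>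
    ⟨a.1 - 1, Nat.sub_one_lt_of_le (lam.parts_pos a.2) (lam.le_of_mem_parts a.2)⟩

theorem map_val_add_one_toMultiset_partExponents {n : ℕ} (lam : n.Partition) :
    (Finsupp.toMultiset (partExponents lam)).map (fun i => i.val + 1) = lam.parts := by
  rw [partExponents, Multiset.toFinsupp_toMultiset, Multiset.map_map]
  refine (Multiset.map_congr rfl fun a _ => ?_).trans lam.parts.attach_map_val
  exact Nat.sub_add_cancel (lam.parts_pos a.2)

theorem partExponents_injective {n : ℕ} :
    Function.Injective (partExponents : n.Partition → Fin n →₀ ℕ) := fun lam mu h => by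
  rw [Nat.Partition.ext_iff, ← map_val_add_one_toMultiset_partExponents lam, h,
    map_val_add_one_toMultiset_partExponents]

variable (σ R : Type*) [Fintype σ] [CommRing R]

theorem esymmAlgHom_monomial_partExponents {n : ℕ} (lam : n.Partition) :
    (MvPolynomial.esymmAlgHom σ R n (MvPolynomial.monomial (partExponents lam) 1) :
      MvPolynomial σ R) = MvPolynomial.esymmPart σ R lam := by
  rw [MvPolynomial.esymmAlgHom_apply, ← Finsupp.toMultiset_toFinsupp (partExponents lam),
    monomial_toFinsupp_one, map_multiset_prod, Multiset.map_map, MvPolynomial.esymmPart,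
    ← map_val_add_one_toMultiset_partExponents, Multiset.map_map]
  simp only [Function.comp_def, MvPolynomial.aeval_X]

theorem linearIndependent_esymmPart {n : ℕ} (hn : n ≤ Fintype.card σ) :
    LinearIndependent R fun lam : n.Partition => MvPolynomial.esymmPart σ R lam := by
  have hmonomial := (MvPolynomial.basisMonomials (Fin n) R).linearIndependent.comp _
    partExponents_injective
  let f : MvPolynomial (Fin n) R →ₗ[R] MvPolynomial σ R :=
    ((MvPolynomial.symmetricSubalgebra σ R).val.comp (MvPolynomial.esymmAlgHom σ R n)).toLinearMap
  have hf : Function.Injective f :=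
    Subtype.val_injective.comp (MvPolynomial.esymmAlgHom_injective R hn)
  have himage : ⇑f ∘ ⇑(MvPolynomial.basisMonomials (Fin n) R) ∘ partExponents =
      fun lam => MvPolynomial.esymmPart σ R lam :=
    funext (esymmAlgHom_monomial_partExponents σ R)
  exact himage ▸ hmonomial.map' f (LinearMap.ker_eq_bot.2 hf)

theorem linearIndependent_elementaryPart (n : ℕ) :
    LinearIndependent ℚ[X] (elementaryPart : n.Partition → MvPowerSeries ℕ+ ℚ[X]) := by
  obtain ⟨s, hs⟩ := Infinite.exists_subset_card_eq ℕ+ n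
  rw [Fintype.linearIndependent_iff]
  intro c hc
  have hrestrict := congrArg (restrict s) hc
  rw [restrict_sum_smul_elementaryPart, map_zero, ← MvPolynomial.coe_zero,
    MvPolynomial.coe_inj] at hrestrict
  exact Fintype.linearIndependent_iff.1 (linearIndependent_esymmPart s ℚ[X] (by simp [hs])) c
    hrestrict

end Independence

section Coloring

variable {n : ℕ}

/-- The proper colorings of the cycle on `Fin (n + 1)` with colors in `ι`, as bare functions, in
which each color `a` is used `x a` times. -/
def properWords {ι : Type*} (n : ℕ) (x : ι →₀ ℕ) : Set (Fin (n + 1) → ι) :=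
  {κ | (∀ i, κ i ≠ κ (i + 1)) ∧ ∑ i, Finsupp.single (κ i) 1 = x}

theorem colorMatrix_apply_of_ne {ι R : Type*} [LinearOrder ι] [CommRing R] (t : R) (x : ι → R)
    {i j : ι} (h : i ≠ j) : colorMatrix t x i j = (if i < j then t else 1) * x j := by
  rcases h.lt_or_gt with h | h <;> simp [colorMatrix, h, h.not_gt]

section Word

variable {ι R : Type*} [LinearOrder ι] [CommRing R] (t : R)

theorem prod_colorMatrix (κ : Fin (n + 1) → ι) :
    ∏ i, colorMatrix (MvPolynomial.C t) MvPolynomial.X (κ i) (κ (i + 1)) =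
      if ∀ i, κ i ≠ κ (i + 1) then MvPolynomial.monomial (∑ i, Finsupp.single (κ i) 1)
        (t ^ Finset.card {i | κ i < κ (i + 1)}) else 0 := by
  split_ifs with h
  · have hascents : ∏ i, (if κ i < κ (i + 1) then MvPolynomial.C t else 1) =
        (MvPolynomial.C (t ^ Finset.card {i | κ i < κ (i + 1)}) : MvPolynomial ι R) := by
      rw [← Finset.prod_filter, Finset.prod_const, map_pow]
    have hvars : ∏ i, MvPolynomial.X (κ (i + 1)) =
        (MvPolynomial.monomial (∑ i, Finsupp.single (κ i) 1) 1 : MvPolynomial ι R) := by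
      rw [MvPolynomial.monomial_sum_one]
      exact Equiv.prod_comp (Equiv.addRight (1 : Fin (n + 1)))
        fun i => (MvPolynomial.X (κ i) : MvPolynomial ι R)
    rw [Finset.prod_congr rfl fun i _ => colorMatrix_apply_of_ne _ _ (h i),
      Finset.prod_mul_distrib, hascents, hvars, MvPolynomial.C_mul_monomial, mul_one]
  · push Not at h
    obtain ⟨i, hi⟩ := h
    refine Finset.prod_eq_zero (Finset.mem_univ i) ?_
    simp [colorMatrix, hi]

theorem coeff_trace_colorMatrix_pow [Fintype ι] (x : ι →₀ ℕ) :
    ((colorMatrix (MvPolynomial.C t) MvPolynomial.X ^ (n + 1)).trace).coeff x =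
      ∑ᶠ κ ∈ properWords n x, t ^ Finset.card {i | κ i < κ (i + 1)} := by
  classical
  have hwords : properWords n x = Finset.filter (fun κ : Fin (n + 1) → ι =>
      (∀ i, κ i ≠ κ (i + 1)) ∧ ∑ i, Finsupp.single (κ i) 1 = x) Finset.univ :=
    (Finset.coe_filter_univ _).symm
  rw [trace_pow_succ_eq_sum_closed_walks, MvPolynomial.coeff_sum, hwords,
    finsum_mem_coe_finset, Finset.sum_filter]
  simp only [prod_colorMatrix, apply_ite (MvPolynomial.coeff x), MvPolynomial.coeff_monomial,
    MvPolynomial.coeff_zero, ite_and]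

theorem trace_colorMatrix_pow [Fintype ι] :
    (colorMatrix (MvPolynomial.C t) (MvPolynomial.X (σ := ι)) ^ (n + 2)).trace =
      ∑ lam : (n + 2).Partition, (∑ D ∈ acyclicOrientations lam,
        t ^ orientationAsc (directedCycle (n + 2)) D) • MvPolynomial.esymmPart ι R lam := by
  rw [trace_pow_succ_eq_of_charpolyRev_eq (charpolyRev_colorMatrix_eq_charpolyRev_transitionMatrix
      _ _ (le_max_left _ (n + 2))) (n + 1), trace_transitionMatrix_pow _ _ (le_max_right _ _),
    ← sum_acyclicOrientations]
  refine Finset.sum_congr rfl fun lam _ => ?_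
  rw [MvPolynomial.smul_eq_C_mul, map_sum, MvPolynomial.esymmPart,
    MvPolynomial.esymm_eq_multiset_esymm]
  simp only [map_pow]

theorem coeff_sum_acyclicOrientations_smul_esymmPart [Fintype ι] (x : ι →₀ ℕ) :
    (∑ lam : (n + 2).Partition, (∑ D ∈ acyclicOrientations lam,
        t ^ orientationAsc (directedCycle (n + 2)) D) • MvPolynomial.esymmPart ι R lam).coeff x =
      ∑ᶠ κ ∈ properWords (n + 1) x, t ^ Finset.card {i | κ i < κ (i + 1)} := by
  rw [← trace_colorMatrix_pow, coeff_trace_colorMatrix_pow]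

end Word

theorem colorAsc_directedCycle (κ : ProperColoring (directedCycle (n + 1))) :
    colorAsc (directedCycle (n + 1)) κ = Finset.card {i | κ i < κ (i + 1)} :=
  ncard_directedCycle_adj_and fun u v => κ u < κ v

theorem bijOn_coe_properWords (m : ℕ+ →₀ ℕ) :
    Set.BijOn (fun (κ : ProperColoring (directedCycle (n + 2))) v => κ v)
      {κ | colorWeight (directedCycle (n + 2)) κ = m} (properWords (n + 1) m) := by
  refine ⟨fun κ hκ => ⟨fun i => κ.valid (underlying_directedCycle_adj.2 (.inl rfl)), hκ⟩,
    DFunLike.coe_injective.injOn, fun κ ⟨hproper, hκ⟩ => ?_⟩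
  refine ⟨SimpleGraph.Coloring.mk κ fun {u v} huv => ?_, hκ, rfl⟩
  rcases underlying_directedCycle_adj.1 huv with rfl | rfl
  · exact hproper u
  · exact (hproper v).symm

theorem coeff_chromaticQuasisymmetric_directedCycle (m : ℕ+ →₀ ℕ) :
    (chromaticQuasisymmetric (directedCycle (n + 2))).coeff m =
      ∑ᶠ κ ∈ properWords (n + 1) m, (Polynomial.X : ℚ[X]) ^ Finset.card {i | κ i < κ (i + 1)} :=
  finsum_mem_eq_of_bijOn _ (bijOn_coe_properWords m) fun κ _ => by rw [colorAsc_directedCycle]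

theorem bijOn_comp_properWords {ι ι' : Type*} (f : ι ↪ ι') (x : ι →₀ ℕ) :
    Set.BijOn (f ∘ ·) (properWords n x) (properWords n (x.embDomain f)) := by
  have hweight (κ : Fin (n + 1) → ι) : ∑ i, Finsupp.single (f (κ i)) 1 =
      Finsupp.embDomain f (∑ i, Finsupp.single (κ i) 1) := by
    rw [Finsupp.embDomain_eq_mapDomain, Finsupp.mapDomain_finsetSum]
    simp only [Finsupp.mapDomain_single]
  refine ⟨fun κ ⟨hproper, hκ⟩ => ⟨fun i => f.injective.ne (hproper i), ?_⟩,
    (f.injective.comp_left).injOn, fun κ ⟨hproper, hκ⟩ => ?_⟩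
  · rw [← hκ]
    exact hweight κ
  · have hrange (i : Fin (n + 1)) : κ i ∈ Set.range f := by
      by_contra hi
      have hzero := Finsupp.embDomain_of_notMem_range f x (κ i) hi
      rw [← hκ, Finsupp.finsetSum_apply, Finset.sum_eq_zero_iff] at hzero
      simpa using hzero i (Finset.mem_univ i)
    choose κ' hκ' using hrange
    obtain rfl : f ∘ κ' = κ := funext hκ'
    refine ⟨κ', ⟨fun i hi => hproper i (congrArg f hi), ?_⟩, rfl⟩
    exact Finsupp.embDomain_injective f ((hweight κ').symm.trans hκ)

theorem chromaticQuasisymmetric_directedCycle :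
    chromaticQuasisymmetric (directedCycle (n + 2)) = ∑ lam : (n + 2).Partition,
      (∑ D ∈ acyclicOrientations lam,
        (Polynomial.X : ℚ[X]) ^ orientationAsc (directedCycle (n + 2)) D) • elementaryPart lam := by
  refine eq_of_restrict_eq fun s => ?_
  ext1 x
  rw [restrict_sum_smul_elementaryPart, MvPolynomial.coeff_coe,
    coeff_sum_acyclicOrientations_smul_esymmPart, MvPowerSeries.coeff_killCompl,
    coeff_chromaticQuasisymmetric_directedCycle]
  exact (finsum_mem_eq_of_bijOn _ (bijOn_comp_properWords _ x) fun κ _ => rfl).symm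

end Coloring

end ChromaticDigraph

end

theorem proposition6p7 (n : ℕ) (hn : 2 ≤ n) (c : n.Partition → Polynomial ℚ) :
    ChromaticDigraph.chromaticQuasisymmetric (ChromaticDigraph.directedCycle n) =
        ∑ lam : n.Partition, c lam • ChromaticDigraph.elementaryPart lam ↔
      ∀ lam : n.Partition, c lam =
        ∑ D ∈ ChromaticDigraph.acyclicOrientations lam,
          (Polynomial.X : Polynomial ℚ) ^
            ChromaticDigraph.orientationAsc (ChromaticDigraph.directedCycle n) D := by
  obtain ⟨n, rfl⟩ := Nat.exists_eq_add_of_le' hn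
  have hindep := ChromaticDigraph.linearIndependent_elementaryPart (n + 2)
  rw [ChromaticDigraph.chromaticQuasisymmetric_directedCycle, ← funext_iff]
  exact hindep.fintypeLinearCombination_injective.eq_iff.trans eq_comm
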